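/- Let $X$ be an infinite-dimensional real Banach space that admits an equivalent norm which is URED. Then there exists an equivalent norm on $X$ which is URED and not WUR, and the class of all such equivalent norms is dense. If, moreover, $X$ admits an equivalent norm which is LUR, then there exists an equivalent norm on $X$ which is URED, LUR and not WUR, and the class of all such equivalent norms is dense. Here an equivalent norm $\|\cdot\|$ on $X$ is called (i) weakly uniformly rotund (WUR) if for all sequences $(x_n),(y_n)$ in $X$ with $\|x_n\|\le 1$, $\|y_n\|\le 1$ and $\left\|\frac{x_n+y_n}{2}\right\|\to 1$ one has $y_n-x_n\to 0$ in the weak topology of $X$; (ii) uniformly rotund in every direction (URED) if for every $v\in X$ with $\|v\|=1$ and all sequences $(x_n),(y_n)$ in $X$ and $(\lambda_n)$ in $\mathbb{R}$ with $\|x_n\|\le 1$, $\|y_n\|\le 1$, $y_n-x_n=\lambda_n v$ and $\left\|\frac{x_n+y_n}{2}\right\|\to 1$ one has $\lambda_n\to 0$; (iii) locally uniformly rotund (LUR) if for every $x\in X$ with $\|x\|=1$ and every sequence $(y_n)$ in $X$ with $\|y_n\|\le 1$ and $\left\|\frac{x+y_n}{2}\right\|\to 1$ one has $\|x-y_n\|\to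 0$. A class $\mathcal{S}$ of equivalent norms on $X$ is dense if for every equivalent norm $\|\cdot\|$ on $X$ and every $\varepsilon>0$ there is a norm $|\!|\!|\cdot|\!|\!|\in\mathcal{S}$ with $|\!|\!|x|\!|\!|\le\|x\|\le(1+\varepsilon)|\!|\!|x|\!|\!|$ for all $x\in X$. -/

import Mathlib

open Filter Topology

namespace Renorming

variable {X : Type*} [NormedAddCommGroup X] [NormedSpace ℝ X]

/-- A seminorm `p` on `X` is an equivalent norm: it is bounded below and above by positive multiples
of the given norm of `X` (in particular `p x = 0` only for `x = 0`). -/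
def IsEquivalentNorm (p : Seminorm ℝ X) : Prop :=
  ∃ a b : ℝ, 0 < a ∧ 0 < b ∧ ∀ x : X, a * ‖x‖ ≤ p x ∧ p x ≤ b * ‖x‖

/-- Weak uniform rotundity. The weak topology is that of `X`; it is the same for all
equivalent norms. -/
def IsWUR (p : Seminorm ℝ X) : Prop :=
  ∀ x y : ℕ → X, (∀ n, p (x n) ≤ 1) → (∀ n, p (y n) ≤ 1) →
    Tendsto (fun n => p ((2⁻¹ : ℝ) • (x n + y n))) atTop (𝓝 1) →
    Tendsto (fun n => toWeakSpace ℝ X (y n - x n)) atTop (𝓝 0)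

/-- Uniform rotundity in every direction. -/
def IsURED (p : Seminorm ℝ X) : Prop :=
  ∀ v : X, p v = 1 → ∀ (x y : ℕ → X) (c : ℕ → ℝ),
    (∀ n, p (x n) ≤ 1) → (∀ n, p (y n) ≤ 1) → (∀ n, y n - x n = c n • v) →
    Tendsto (fun n => p ((2⁻¹ : ℝ) • (x n + y n))) atTop (𝓝 1) →
    Tendsto c atTop (𝓝 0)

/-- Local uniform rotundity (at every point of the unit sphere). -/
def IsLUR (p : Seminorm ℝ X) : Prop :=
  ∀ x : X, p x = 1 → ∀ y : ℕ → X, (∀ n, p (y n) ≤ 1) →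
    Tendsto (fun n => p ((2⁻¹ : ℝ) • (x + y n))) atTop (𝓝 1) →
    Tendsto (fun n => p (x - y n)) atTop (𝓝 0)

/-- A class `S` of equivalent norms is dense if every equivalent norm `p` can be approximated
uniformly on bounded sets by members `q` of `S`. -/
def IsDenseClass (S : Set (Seminorm ℝ X)) : Prop :=
  ∀ p : Seminorm ℝ X, IsEquivalentNorm p → ∀ ε : ℝ, 0 < ε →
    ∃ q ∈ S, ∀ x : X, q x ≤ p x ∧ p x ≤ (1 + ε) * q x

end Renorming

/-!
Let `N` be a URED norm and `p` the norm to be approximated. The new norm is a supremum of seminorms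
`G i`: one is the `ℓ²`-sum of a norm close to `p` and of a small multiple of `N`; each of the others
is the `ℓ²`-sum of `|F n|`, where `F n = B + r φ₂ₙ₊₁` is a small perturbation of a supporting
functional `B` of the unit ball of `p`, and of a small seminorm `rest n`.

* WUR fails: at a point `z n` where `F n` exceeds the other functionals, the new norm is governed by
  `F n` and `rest n`. The first vanishes at `v n = w₀ + w₂ₙ₊₂` and the second almost does, so the
  unit ball contains almost flat segments in the directions `v n`, on which `φ₀` is constantly `1`.
* URED survives, because a fixed direction `v` is seen by all `rest n` at once: either the
  Hilbertian seminorm `T`, common to all of them, does not vanish at `v`, or `v` is fixed by every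
  projection `proj n` and the term `N ∘ proj n` is rotund in this direction.
* LUR survives, because the limsup of the `|F n|`, slightly enlarged, is part of the new norm: only
  finitely many `G i` are almost norming at a given point, and each contains a multiple of `N`.
-/

open scoped NNReal

namespace Renorming

section Seminorm

variable {E : Type*} [AddCommGroup E] [Module ℝ E]

theorem nnreal_smul_apply (t : ℝ≥0) (a : Seminorm ℝ E) (x : E) : (t • a) x = t * a x := rfl

theorem sqrt_add_sq_add_sq_le (a b c d : ℝ) :
    √((a + c) ^ 2 + (b + d) ^ 2) ≤ √(a ^ 2 + b ^ 2) + √(c ^ 2 + d ^ 2) := by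
  have h := norm_add_le (a + b * Complex.I) (c + d * Complex.I)
  rwa [show a + b * Complex.I + (c + d * Complex.I) = (a + c : ℝ) + (b + d : ℝ) * Complex.I by
    push_cast; ring, Complex.norm_add_mul_I, Complex.norm_add_mul_I, Complex.norm_add_mul_I] at h

/-- The `ℓ²`-sum of two seminorms. -/
noncomputable def sqAdd (a b : Seminorm ℝ E) : Seminorm ℝ E :=
  Seminorm.of (fun x => √(a x ^ 2 + b x ^ 2))
    (fun x y => by
      refine le_trans ?_ (sqrt_add_sq_add_sq_le _ _ _ _)
      gcongr <;> exact map_add_le_add _ x y)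
    (fun r x => by
      rw [map_smul_eq_mul, map_smul_eq_mul, mul_pow, mul_pow, ← mul_add,
        Real.sqrt_mul (by positivity), Real.sqrt_sq (norm_nonneg r)])

theorem sqAdd_sq (a b : Seminorm ℝ E) (x : E) : sqAdd a b x ^ 2 = a x ^ 2 + b x ^ 2 :=
  Real.sq_sqrt (by positivity)

theorem sqAdd_le_add (a b : Seminorm ℝ E) (x : E) : sqAdd a b x ≤ a x + b x := by
  refine le_of_sq_le_sq ?_ (by positivity)
  rw [sqAdd_sq]
  nlinarith [apply_nonneg a x, apply_nonneg b x]

theorem le_sqAdd_left (a b : Seminorm ℝ E) (x : E) : a x ≤ sqAdd a b x :=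
  Real.le_sqrt_of_sq_le (le_add_of_nonneg_right (sq_nonneg _))

theorem map_midpoint_le (a : Seminorm ℝ E) (x y : E) :
    a ((2⁻¹ : ℝ) • (x + y)) ≤ (a x + a y) / 2 := by
  rw [map_smul_eq_mul, norm_inv, Real.norm_ofNat]
  linarith [map_add_le_add a x y]

/-- The convexity defect of the square of a seminorm at the midpoint of `x` and `y`. Rotundity
properties amount to lower bounds for it. -/
noncomputable def midpointDefect (a : Seminorm ℝ E) (x y : E) : ℝ :=
  (a x ^ 2 + a y ^ 2) / 2 - a ((2⁻¹ : ℝ) • (x + y)) ^ 2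

theorem sq_half_sub_le_midpointDefect (a : Seminorm ℝ E) (x y : E) :
    ((a x - a y) / 2) ^ 2 ≤ midpointDefect a x y := by
  have h : a ((2⁻¹ : ℝ) • (x + y)) ^ 2 ≤ ((a x + a y) / 2) ^ 2 := by
    gcongr
    exact map_midpoint_le a x y
  unfold midpointDefect
  linear_combination h

theorem midpointDefect_nonneg (a : Seminorm ℝ E) (x y : E) : 0 ≤ midpointDefect a x y :=
  (sq_nonneg _).trans (sq_half_sub_le_midpointDefect a x y)

theorem midpointDefect_sqAdd (a b : Seminorm ℝ E) (x y : E) :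
    midpointDefect (sqAdd a b) x y = midpointDefect a x y + midpointDefect b x y := by
  simp only [midpointDefect, sqAdd_sq]
  ring

theorem midpointDefect_le_sqAdd_left (a b : Seminorm ℝ E) (x y : E) :
    midpointDefect a x y ≤ midpointDefect (sqAdd a b) x y := by
  rw [midpointDefect_sqAdd]
  exact le_add_of_nonneg_right (midpointDefect_nonneg b x y)

theorem midpointDefect_le_sqAdd_right (a b : Seminorm ℝ E) (x y : E) :
    midpointDefect b x y ≤ midpointDefect (sqAdd a b) x y := by
  rw [midpointDefect_sqAdd]
  exact le_add_of_nonneg_left (midpointDefect_nonneg a x y)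

theorem midpointDefect_smul (t : ℝ≥0) (a : Seminorm ℝ E) (x y : E) :
    midpointDefect (t • a) x y = t ^ 2 * midpointDefect a x y := by
  simp only [midpointDefect, nnreal_smul_apply]
  ring

theorem midpointDefect_comp {F : Type*} [AddCommGroup F] [Module ℝ F] (a : Seminorm ℝ F)
    (f : E →ₗ[ℝ] F) (x y : E) : midpointDefect (a.comp f) x y = midpointDefect a (f x) (f y) := by
  simp only [midpointDefect, Seminorm.comp_apply, map_smul, map_add]

theorem midpointDefect_normSeminorm {H : Type*} [NormedAddCommGroup H] [InnerProductSpace ℝ H]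
    (x y : H) : midpointDefect (normSeminorm ℝ H) x y = ‖x - y‖ ^ 2 / 4 := by
  have h := parallelogram_law_with_norm ℝ x y
  simp only [midpointDefect, coe_normSeminorm, norm_smul, norm_inv, Real.norm_ofNat]
  linear_combination -h / 4

theorem abs_sub_le_of_midpointDefect_le {a : Seminorm ℝ E} {x y : E} {s : ℝ} (hs : 0 ≤ s)
    (h : midpointDefect a x y ≤ s ^ 2) : |a x - a y| ≤ 2 * s := by
  have hhalf := abs_le_of_sq_le_sq ((sq_half_sub_le_midpointDefect a x y).trans h) hs
  rw [abs_div, abs_two] at hhalf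
  linarith

theorem max_sub_two_mul_le_map_midpoint {a : Seminorm ℝ E} {x y : E} {s : ℝ} (hs : 0 ≤ s)
    (h : midpointDefect a x y ≤ s ^ 2) :
    max (a x) (a y) - 2 * s ≤ a ((2⁻¹ : ℝ) • (x + y)) := by
  obtain ⟨hxy, hyx⟩ := abs_le.1 (abs_sub_le_of_midpointDefect_le hs h)
  have hmid := apply_nonneg a ((2⁻¹ : ℝ) • (x + y))
  unfold midpointDefect at h
  by_contra! hlt
  rcases max_choice (a x) (a y) with hm | hm <;> rw [hm] at hlt <;> nlinarith

theorem exists_map_le_and_map_sub_le (a : Seminorm ℝ E) {y : E} {ρ t : ℝ} (hρ : 0 ≤ ρ)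
    (ht : 0 < t) (hy : a y ≤ ρ + t) : ∃ z, a z ≤ ρ ∧ a (y - z) ≤ t := by
  have hpos : 0 < ρ + t := by positivity
  refine ⟨(ρ / (ρ + t)) • y, ?_, ?_⟩
  · rw [map_smul_eq_mul, Real.norm_of_nonneg (by positivity)]
    exact (mul_le_mul_of_nonneg_left hy (by positivity)).trans_eq (div_mul_cancel₀ _ hpos.ne')
  · have hsub : y - (ρ / (ρ + t)) • y = (t / (ρ + t)) • y := by
      rw [sub_eq_iff_eq_add', ← add_smul, ← add_div, div_self hpos.ne', one_smul]
    rw [hsub, map_smul_eq_mul, Real.norm_of_nonneg (by positivity)]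
    exact (mul_le_mul_of_nonneg_left hy (by positivity)).trans_eq (div_mul_cancel₀ _ hpos.ne')

theorem isBoundedUnder_ge_apply (a : ℕ → Seminorm ℝ E) (x : E) :
    IsBoundedUnder (· ≥ ·) atTop fun n => a n x :=
  isBoundedUnder_of ⟨0, fun n => apply_nonneg (a n) x⟩

/-- The pointwise upper limit of a pointwise bounded sequence of seminorms. -/
noncomputable def limsupSeminorm (a : ℕ → Seminorm ℝ E)
    (h : ∀ x, IsBoundedUnder (· ≤ ·) atTop fun n => a n x) : Seminorm ℝ E :=
  Seminorm.ofSMulLE (fun x => limsup (fun n => a n x) atTop)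
    (by simp)
    (fun x y => by
      refine (limsup_le_limsup (.of_forall fun n => map_add_le_add (a n) x y)
        (isBoundedUnder_ge_apply a _).isCoboundedUnder_le ?_).trans
        (limsup_add_le (isBoundedUnder_ge_apply a x) (h x)
          (isBoundedUnder_ge_apply a y).isCoboundedUnder_le (h y))
      exact isBoundedUnder_le_add (h x) (h y))
    (fun r x => by
      simp only [map_smul_eq_mul]
      refine (limsup_mul_le (.of_forall fun _ => norm_nonneg r) isBoundedUnder_const
        (.of_forall fun n => apply_nonneg (a n) x) (h x)).trans_eq ?_
      rw [limsup_const])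

theorem limsupSeminorm_le {a : ℕ → Seminorm ℝ E}
    (h : ∀ x, IsBoundedUnder (· ≤ ·) atTop fun n => a n x) {x : E} {c : ℝ}
    (hc : ∀ᶠ n in atTop, a n x ≤ c) : limsupSeminorm a h x ≤ c :=
  limsup_le_of_le (isBoundedUnder_ge_apply a x).isCoboundedUnder_le hc

theorem eventually_lt_of_limsupSeminorm_lt {a : ℕ → Seminorm ℝ E}
    (h : ∀ x, IsBoundedUnder (· ≤ ·) atTop fun n => a n x) {x : E} {c : ℝ}
    (hc : limsupSeminorm a h x < c) : ∀ᶠ n in atTop, a n x < c :=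
  eventually_lt_of_limsup_lt hc (h x)

end Seminorm

variable {X : Type*} [NormedAddCommGroup X] [NormedSpace ℝ X]

section MidpointDefect

variable {N : Seminorm ℝ X}

theorem IsURED.exists_forall_abs_lt (hN : IsURED N) {v : X} (hv : N v = 1) {ε : ℝ} (hε : 0 < ε) :
    ∃ η > 0, ∀ (x y : X) (c : ℝ), N x ≤ 1 → N y ≤ 1 → y - x = c • v →
      1 - η < N ((2⁻¹ : ℝ) • (x + y)) → |c| < ε := by
  by_contra! H
  choose x y c hx hy hxy hmid hc using fun n : ℕ => H (1 / ((n : ℝ) + 1)) (by positivity)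
  have hlow : Tendsto (fun n : ℕ => 1 - 1 / ((n : ℝ) + 1)) atTop (𝓝 1) := by
    simpa only [sub_zero] using tendsto_one_div_add_atTop_nhds_zero_nat.const_sub (1 : ℝ)
  have hone : Tendsto (fun n => N ((2⁻¹ : ℝ) • (x n + y n))) atTop (𝓝 1) :=
    tendsto_of_tendsto_of_tendsto_of_le_of_le hlow tendsto_const_nhds (fun n => (hmid n).le)
      fun n => by linarith [map_midpoint_le N (x n) (y n), hx n, hy n]
  have hlim := ge_of_tendsto' (hN v hv x y c hx hy hxy hone).abs hc
  rw [abs_zero] at hlim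
  exact hlim.not_gt hε

theorem IsURED.exists_midpointDefect (hN : IsURED N) {v : X} (hv : N v ≠ 0) {ε R : ℝ}
    (hε : 0 < ε) (hR : 0 < R) :
    ∃ δ > 0, ∀ (x y : X) (c : ℝ), N x ≤ R → N y ≤ R → y - x = c • v →
      midpointDefect N x y < δ → |c| < ε := by
  have hv0 : 0 < N v := (apply_nonneg N v).lt_of_ne' hv
  have hunit : N ((N v)⁻¹ • v) = 1 := by
    rw [map_smul_eq_mul, norm_inv, Real.norm_of_nonneg hv0.le, inv_mul_cancel₀ hv]
  obtain ⟨η, hη, H⟩ := hN.exists_forall_abs_lt hunit (ε := ε * N v / R) (by positivity)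
  have hm0 : 0 < ε * N v / 2 := by positivity
  set s := η * (ε * N v / 2) / 4 with hs
  refine ⟨s ^ 2, by positivity, fun x y c hx hy hxy hD => ?_⟩
  set m := max (N x) (N y)
  have hxm : N x ≤ m := le_max_left _ _
  have hym : N y ≤ m := le_max_right _ _
  have hcv : |c| * N v ≤ 2 * m := by
    rw [← Real.norm_eq_abs, ← map_smul_eq_mul, ← hxy]
    linarith [map_sub_le_add N y x]
  refine lt_of_mul_lt_mul_right ?_ hv0.le
  rcases lt_or_ge m (ε * N v / 2) with hsmall | hlarge
  · linarith
  have hmpos : 0 < m := hm0.trans_le hlarge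
  have hmR : m ≤ R := max_le hx hy
  have hscale : ∀ z, N (m⁻¹ • z) = N z / m := fun z => by
    rw [map_smul_eq_mul, norm_inv, Real.norm_of_nonneg hmpos.le, inv_mul_eq_div]
  have hmid : 1 - η < N ((2⁻¹ : ℝ) • (m⁻¹ • x + m⁻¹ • y)) := by
    rw [← smul_add, smul_comm, hscale, lt_div_iff₀ hmpos]
    have := max_sub_two_mul_le_map_midpoint (by positivity) hD.le
    nlinarith
  have hdiff : m⁻¹ • y - m⁻¹ • x = (c * N v / m) • (N v)⁻¹ • v := by
    rw [← smul_sub, hxy, smul_smul, smul_smul]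
    congr 1
    field_simp
  have hlt := H _ _ _ (by rwa [hscale, div_le_one hmpos]) (by rwa [hscale, div_le_one hmpos])
    hdiff hmid
  rw [abs_div, abs_of_pos hmpos, abs_mul, abs_of_pos hv0, div_lt_div_iff₀ hmpos hR] at hlt
  nlinarith [mul_pos hε hv0]

theorem tendsto_midpointDefect_zero {x y : ℕ → X} (hx : ∀ n, N (x n) ≤ 1)
    (hy : ∀ n, N (y n) ≤ 1)
    (h : Tendsto (fun n => N ((2⁻¹ : ℝ) • (x n + y n))) atTop (𝓝 1)) :
    Tendsto (fun n => midpointDefect N (x n) (y n)) atTop (𝓝 0) := by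
  have hub : Tendsto (fun n => 1 - N ((2⁻¹ : ℝ) • (x n + y n)) ^ 2) atTop (𝓝 0) := by
    simpa only [one_pow, sub_self] using (h.pow 2).const_sub 1
  refine squeeze_zero (fun n => midpointDefect_nonneg N _ _) (fun n => ?_) hub
  unfold midpointDefect
  linarith [pow_le_one₀ (apply_nonneg N (x n)) (hx n) (n := 2),
    pow_le_one₀ (apply_nonneg N (y n)) (hy n) (n := 2)]

theorem isURED_of_forall_exists_midpointDefect
    (H : ∀ v, N v = 1 → ∀ ε > 0, ∃ δ > 0, ∀ (x y : X) (c : ℝ), N x ≤ 1 → N y ≤ 1 →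
      y - x = c • v → midpointDefect N x y < δ → |c| < ε) : IsURED N := by
  intro v hv x y c hx hy hxy h
  rw [Metric.tendsto_nhds]
  intro ε hε
  obtain ⟨δ, hδ, Hδ⟩ := H v hv ε hε
  filter_upwards [(tendsto_midpointDefect_zero hx hy h).eventually_lt_const hδ] with n hn
  rw [Real.dist_0_eq_abs]
  exact Hδ _ _ _ (hx n) (hy n) (hxy n) hn

theorem IsLUR.exists_forall_map_sub_lt_of_eq_one (hN : IsLUR N) {x : X} (hx : N x = 1) {ε : ℝ}
    (hε : 0 < ε) :
    ∃ η > 0, ∀ y, N y ≤ 1 → 1 - η < N ((2⁻¹ : ℝ) • (x + y)) → N (x - y) < ε := by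
  by_contra! H
  choose y hy hmid hxy using fun n : ℕ => H (1 / ((n : ℝ) + 1)) (by positivity)
  have hlow : Tendsto (fun n : ℕ => 1 - 1 / ((n : ℝ) + 1)) atTop (𝓝 1) := by
    simpa only [sub_zero] using tendsto_one_div_add_atTop_nhds_zero_nat.const_sub (1 : ℝ)
  have hone : Tendsto (fun n => N ((2⁻¹ : ℝ) • (x + y n))) atTop (𝓝 1) :=
    tendsto_of_tendsto_of_tendsto_of_le_of_le hlow tendsto_const_nhds (fun n => (hmid n).le)
      fun n => by linarith [map_midpoint_le N x (y n), hy n]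
  exact (ge_of_tendsto' (hN x hx y hy hone) hxy).not_gt hε

theorem IsLUR.exists_forall_map_sub_lt (hN : IsLUR N) (x : X) {ε : ℝ} (hε : 0 < ε) :
    ∃ η > 0, ∀ y, N y ≤ N x → N x - η < N ((2⁻¹ : ℝ) • (x + y)) → N (x - y) < ε := by
  rcases (apply_nonneg N x).eq_or_lt with hx | hx
  · exact ⟨1, one_pos, fun y hy _ => by linarith [map_sub_le_add N x y]⟩
  have hscale : ∀ z, N ((N x)⁻¹ • z) = N z / N x := fun z => by
    rw [map_smul_eq_mul, norm_inv, Real.norm_of_nonneg hx.le, inv_mul_eq_div]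
  obtain ⟨η, hη, H⟩ := hN.exists_forall_map_sub_lt_of_eq_one
    (by rw [hscale, div_self hx.ne'] : N ((N x)⁻¹ • x) = 1) (div_pos hε hx)
  refine ⟨η * N x, by positivity, fun y hy hmid => ?_⟩
  have h := H ((N x)⁻¹ • y) (by rwa [hscale, div_le_one hx])
  rw [← smul_add, smul_comm, hscale, ← smul_sub, hscale, div_lt_div_iff_of_pos_right hx,
    lt_div_iff₀ hx] at h
  exact h (by linarith)

theorem IsLUR.exists_midpointDefect (hN : IsLUR N) (x : X) {ε : ℝ} (hε : 0 < ε) :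
    ∃ δ > 0, ∀ y : X, midpointDefect N x y < δ → N (x - y) < ε := by
  obtain ⟨η, hη, H⟩ := hN.exists_forall_map_sub_lt x (half_pos hε)
  obtain ⟨s, hs, hs_lt⟩ := exists_between (lt_min (div_pos hη three_pos) (div_pos hε four_pos))
  obtain ⟨hsη, hsε⟩ := lt_min_iff.1 hs_lt
  refine ⟨s ^ 2, by positivity, fun y hD => ?_⟩
  have hxy := (abs_le.1 (abs_sub_le_of_midpointDefect_le hs.le hD.le)).1
  have hmid := max_sub_two_mul_le_map_midpoint hs.le hD.le
  obtain ⟨z, hz, hyz⟩ := exists_map_le_and_map_sub_le N (apply_nonneg N x)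
    (mul_pos two_pos hs) (by linarith : N y ≤ N x + 2 * s)
  have hmidz : N ((2⁻¹ : ℝ) • (x + y)) ≤ N ((2⁻¹ : ℝ) • (x + z)) + s := by
    have h := map_add_le_add N ((2⁻¹ : ℝ) • (x + z)) ((2⁻¹ : ℝ) • (y - z))
    rw [← smul_add, add_add_sub_cancel, map_smul_eq_mul N _ (y - z), norm_inv, Real.norm_ofNat] at h
    linarith
  have hxz := H z hz (by linarith [le_max_left (N x) (N y)])
  have htri := map_sub_le_add N (x - z) (y - z)
  rw [sub_sub_sub_cancel_right] at htri
  linarith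

theorem isLUR_of_forall_exists_midpointDefect
    (H : ∀ x, N x = 1 → ∀ ε > 0, ∃ δ > 0, ∀ y, N y ≤ 1 → midpointDefect N x y < δ →
      N (x - y) < ε) : IsLUR N := by
  intro x hx y hy h
  rw [Metric.tendsto_nhds]
  intro ε hε
  obtain ⟨δ, hδ, Hδ⟩ := H x hx ε hε
  filter_upwards [(tendsto_midpointDefect_zero (fun _ => hx.le) hy h).eventually_lt_const hδ]
    with n hn
  rw [Real.dist_0_eq_abs, abs_of_nonneg (apply_nonneg N _)]
  exact Hδ _ (hy n) hn

end MidpointDefect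

section Supremum

variable {ι : Type*} {E : Type*} [AddCommGroup E] [Module ℝ E] {G : ι → Seminorm ℝ E}

theorem le_iSup_apply (hG : BddAbove (Set.range G)) (i : ι) (x : E) : G i x ≤ (⨆ j, G j) x :=
  (le_ciSup hG i : G i ≤ ⨆ j, G j) x

theorem iSup_apply_le [Nonempty ι] (hG : BddAbove (Set.range G)) {x : E} {c : ℝ}
    (h : ∀ i, G i x ≤ c) : (⨆ i, G i) x ≤ c := by
  rw [Seminorm.iSup_apply hG]
  exact ciSup_le h

theorem exists_midpointDefect_lt_of_iSup [Nonempty ι] (hG : BddAbove (Set.range G)) {x y : E}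
    {δ : ℝ} (h : midpointDefect (⨆ i, G i) x y < δ) :
    ∃ i, ((⨆ j, G j) x ^ 2 - G i x ^ 2) / 2 < δ ∧ midpointDefect (G i) x y < δ := by
  set q := ⨆ i, G i
  obtain ⟨i, hi⟩ : ∃ i, (q x ^ 2 + q y ^ 2) / 2 - δ < G i ((2⁻¹ : ℝ) • (x + y)) ^ 2 := by
    by_contra! H
    have hsq : 0 ≤ (q x ^ 2 + q y ^ 2) / 2 - δ := (sq_nonneg _).trans (H (Classical.arbitrary ι))
    have hq : q ((2⁻¹ : ℝ) • (x + y)) ^ 2 ≤ (q x ^ 2 + q y ^ 2) / 2 - δ :=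
      (Real.le_sqrt (apply_nonneg q _) hsq).1
        (iSup_apply_le hG fun i => Real.le_sqrt_of_sq_le (H i))
    unfold midpointDefect at h
    linarith
  have hx : G i x ^ 2 ≤ q x ^ 2 := by gcongr; exact le_iSup_apply hG i x
  have hy : G i y ^ 2 ≤ q y ^ 2 := by gcongr; exact le_iSup_apply hG i y
  have hmid : G i ((2⁻¹ : ℝ) • (x + y)) ^ 2 ≤ (G i x ^ 2 + G i y ^ 2) / 2 :=
    sub_nonneg.1 (midpointDefect_nonneg (G i) x y)
  refine ⟨i, ?_, ?_⟩
  · linarith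
  · unfold midpointDefect
    linarith

end Supremum

section Rotundity

variable {ι : Type*} [Nonempty ι] {G : ι → Seminorm ℝ X}

theorem isURED_iSup (hG : BddAbove (Set.range G))
    (H : ∀ v, (⨆ i, G i) v = 1 → ∀ ε > 0, ∃ δ > 0, ∀ (i : ι) (x y : X) (c : ℝ),
      (⨆ i, G i) x ≤ 1 → (⨆ i, G i) y ≤ 1 → y - x = c • v →
      midpointDefect (G i) x y < δ → |c| < ε) : IsURED (⨆ i, G i) := by
  refine isURED_of_forall_exists_midpointDefect fun v hv ε hε => ?_
  obtain ⟨δ, hδ, Hδ⟩ := H v hv ε hε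
  refine ⟨δ, hδ, fun x y c hx hy hxy hD => ?_⟩
  obtain ⟨i, -, hi⟩ := exists_midpointDefect_lt_of_iSup hG hD
  exact Hδ i x y c hx hy hxy hi

theorem isLUR_iSup (hG : BddAbove (Set.range G))
    (H : ∀ x, (⨆ i, G i) x = 1 → ∀ ε > 0, ∃ δ > 0, ∀ (i : ι) (y : X),
      ((⨆ i, G i) x ^ 2 - G i x ^ 2) / 2 < δ → midpointDefect (G i) x y < δ →
      (⨆ i, G i) (x - y) < ε) : IsLUR (⨆ i, G i) := by
  refine isLUR_of_forall_exists_midpointDefect fun x hx ε hε => ?_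
  obtain ⟨δ, hδ, Hδ⟩ := H x hx ε hε
  refine ⟨δ, hδ, fun y _ hD => ?_⟩
  obtain ⟨i, hxi, hi⟩ := exists_midpointDefect_lt_of_iSup hG hD
  exact Hδ i y hxi hi

theorem IsWUR.tendsto_apply_sub {q : Seminorm ℝ X} (hq : IsWUR q) {x y : ℕ → X}
    (hx : ∀ n, q (x n) ≤ 1) (hy : ∀ n, q (y n) ≤ 1)
    (hmid : Tendsto (fun n => q ((2⁻¹ : ℝ) • (x n + y n))) atTop (𝓝 1)) (f : X →L[ℝ] ℝ) :
    Tendsto (fun n => f (y n - x n)) atTop (𝓝 0) := by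
  have hf := WeakBilin.eval_continuous (topDualPairing ℝ X).flip f
  rw [← map_zero f]
  exact (hf.tendsto 0).comp (hq x y hx hy hmid)

theorem IsWUR.tendsto_apply_of_map_add_le {q : Seminorm ℝ X} (hq : IsWUR q) {z u : ℕ → X}
    {η : ℕ → ℝ} {K : ℝ} (hz : ∀ n, 1 ≤ q (z n)) (hK : ∀ n, q (z n) ≤ K) (hη : Tendsto η atTop (𝓝 0))
    (hadd : ∀ n, q (z n + u n) ≤ q (z n) + η n) (hsub : ∀ n, q (z n - u n) ≤ q (z n) + η n)
    (f : X →L[ℝ] ℝ) : Tendsto (fun n => f (u n)) atTop (𝓝 0) := by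
  have hη0 : ∀ n, 0 ≤ η n := fun n => by
    have h := map_midpoint_le q (z n + u n) (z n - u n)
    rw [show (2⁻¹ : ℝ) • (z n + u n + (z n - u n)) = z n by module] at h
    linarith [hadd n, hsub n]
  set s := fun n => q (z n) + η n
  have hs0 : ∀ n, 0 < s n := fun n => by linarith [hz n, hη0 n]
  have hscale : ∀ n x, q ((s n)⁻¹ • x) = q x / s n := fun n x => by
    rw [map_smul_eq_mul, norm_inv, Real.norm_of_nonneg (hs0 n).le, inv_mul_eq_div]
  have hlim : Tendsto (fun n => q (z n) / s n) atTop (𝓝 1) := by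
    refine tendsto_of_tendsto_of_tendsto_of_le_of_le (g := fun n => 1 - η n)
      (by simpa only [sub_zero] using hη.const_sub 1) tendsto_const_nhds (fun n => ?_)
      (fun n => (div_le_one (hs0 n)).2 (by linarith [hη0 n]))
    rw [le_div_iff₀ (hs0 n)]
    nlinarith [hz n, hη0 n]
  have hmid : ∀ n, (2⁻¹ : ℝ) • ((s n)⁻¹ • (z n - u n) + (s n)⁻¹ • (z n + u n)) =
      (s n)⁻¹ • z n := fun n => by module
  have hf := hq.tendsto_apply_sub (x := fun n => (s n)⁻¹ • (z n - u n))
    (y := fun n => (s n)⁻¹ • (z n + u n))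
    (fun n => by rw [hscale, div_le_one (hs0 n)]; exact hsub n)
    (fun n => by rw [hscale, div_le_one (hs0 n)]; exact hadd n)
    (by simpa only [hmid, hscale] using hlim) f
  have hu : ∀ n, f (u n) = s n / 2 * f ((s n)⁻¹ • (z n + u n) - (s n)⁻¹ • (z n - u n)) :=
    fun n => by
      rw [← smul_sub, show z n + u n - (z n - u n) = (2 : ℝ) • u n by module, map_smul, map_smul,
        smul_eq_mul, smul_eq_mul]
      field_simp [(hs0 n).ne']
  refine squeeze_zero_norm (a := fun n => (K + η n) / 2 *
    |f ((s n)⁻¹ • (z n + u n) - (s n)⁻¹ • (z n - u n))|) (fun n => ?_)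
    (by simpa only [abs_zero, mul_zero] using ((hη.const_add K).div_const 2).mul hf.abs)
  rw [hu, norm_mul, Real.norm_of_nonneg (half_pos (hs0 n)).le, Real.norm_eq_abs]
  gcongr
  exact add_le_add (hK n) le_rfl

end Rotundity

section IsEquivalentNorm

variable {p N : Seminorm ℝ X}

theorem IsEquivalentNorm.continuous (hp : IsEquivalentNorm p) : Continuous p := by
  obtain ⟨a, b, -, -, h⟩ := hp
  refine Seminorm.continuous_of_continuousAt_zero ?_
  rw [ContinuousAt, map_zero]
  exact squeeze_zero (fun x => apply_nonneg p x) (fun x => (h x).2)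
    (Continuous.tendsto' (by fun_prop) _ _ (by simp))

theorem IsEquivalentNorm.eq_zero (hp : IsEquivalentNorm p) {x : X} (h : p x = 0) : x = 0 := by
  obtain ⟨a, b, ha, -, hab⟩ := hp
  have := (hab x).1
  rw [h] at this
  exact norm_le_zero_iff.1 (nonpos_of_mul_nonpos_right this ha)

theorem IsEquivalentNorm.exists_eq_one [Nontrivial X] (hp : IsEquivalentNorm p) :
    ∃ x, p x = 1 := by
  obtain ⟨x, hx⟩ := exists_ne (0 : X)
  have hpx : p x ≠ 0 := fun h => hx (hp.eq_zero h)
  refine ⟨(p x)⁻¹ • x, ?_⟩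
  rw [map_smul_eq_mul, norm_inv, Real.norm_of_nonneg (apply_nonneg p x), inv_mul_cancel₀ hpx]

theorem IsEquivalentNorm.exists_le_mul (hp : IsEquivalentNorm p) (hN : IsEquivalentNorm N) :
    ∃ M > 0, ∀ x, N x ≤ M * p x := by
  obtain ⟨a, _, ha, _, hab⟩ := hp
  obtain ⟨_, b, _, hb, hab'⟩ := hN
  refine ⟨b / a, by positivity, fun x => ?_⟩
  calc N x ≤ b * ‖x‖ := (hab' x).2
    _ ≤ b * (p x / a) := by
        gcongr
        exact (le_div_iff₀' ha).2 (hab x).1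
    _ = b / a * p x := by ring

theorem IsEquivalentNorm.of_le_mul (hp : IsEquivalentNorm p) {s t : ℝ} (hs : 0 < s) (ht : 0 < t)
    (hle : ∀ x, N x ≤ s * p x) (hge : ∀ x, p x ≤ t * N x) : IsEquivalentNorm N := by
  obtain ⟨a, b, ha, hb, hab⟩ := hp
  refine ⟨a / t, s * b, by positivity, by positivity, fun x => ⟨?_, ?_⟩⟩
  · rw [div_mul_eq_mul_div, div_le_iff₀' ht]
    exact (hab x).1.trans (hge x)
  · rw [mul_assoc]
    exact (hle x).trans (by gcongr; exact (hab x).2)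

theorem IsEquivalentNorm.nnreal_smul (hp : IsEquivalentNorm p) {t : ℝ≥0} (ht : 0 < t) :
    IsEquivalentNorm (t • p) := by
  have ht' : (0 : ℝ) < t := ht
  exact hp.of_le_mul ht' (inv_pos.2 ht') (fun x => le_rfl) fun x =>
    (inv_mul_cancel_left₀ ht'.ne' (p x)).ge

theorem IsEquivalentNorm.sqAdd (hp : IsEquivalentNorm p) (hN : IsEquivalentNorm N) :
    IsEquivalentNorm (sqAdd p N) := by
  obtain ⟨M, hM, hle⟩ := hp.exists_le_mul hN
  refine hp.of_le_mul (s := 1 + M) (t := 1) (by positivity) one_pos (fun x => ?_) fun x => ?_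
  · linarith [sqAdd_le_add p N x, hle x]
  · rw [one_mul]
    exact le_sqAdd_left p N x

theorem IsURED.of_mul_midpointDefect_le (hN : IsURED N) (hNe : IsEquivalentNorm N)
    (hp : IsEquivalentNorm p) {c : ℝ} (hc : 0 < c)
    (h : ∀ x y, c * midpointDefect N x y ≤ midpointDefect p x y) : IsURED p := by
  refine isURED_of_forall_exists_midpointDefect fun v hv ε hε => ?_
  have hNv : N v ≠ 0 := fun h0 => by simp [hNe.eq_zero h0] at hv
  obtain ⟨M, hM, hle⟩ := hp.exists_le_mul hNe
  have hball : ∀ {x}, p x ≤ 1 → N x ≤ M := fun {x} hx => (hle x).trans (by nlinarith)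
  obtain ⟨δ, hδ, H⟩ := hN.exists_midpointDefect hNv hε hM
  exact ⟨c * δ, by positivity, fun x y t hx hy hxy hD => H x y t (hball hx) (hball hy) hxy
    (lt_of_mul_lt_mul_left ((h x y).trans_lt hD) hc.le)⟩

theorem IsLUR.of_mul_midpointDefect_le (hN : IsLUR N) (hNe : IsEquivalentNorm N)
    (hp : IsEquivalentNorm p) {c : ℝ} (hc : 0 < c)
    (h : ∀ x y, c * midpointDefect N x y ≤ midpointDefect p x y) : IsLUR p := by
  refine isLUR_of_forall_exists_midpointDefect fun x _ ε hε => ?_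
  obtain ⟨M, hM, hle⟩ := hNe.exists_le_mul hp
  obtain ⟨δ, hδ, H⟩ := hN.exists_midpointDefect x (div_pos hε hM)
  refine ⟨c * δ, by positivity, fun y _ hD => (hle _).trans_lt ?_⟩
  rw [← lt_div_iff₀' hM]
  exact H y (lt_of_mul_lt_mul_left ((h x y).trans_lt hD) hc.le)

theorem IsURED.nnreal_smul (hN : IsURED N) (hNe : IsEquivalentNorm N) {t : ℝ≥0} (ht : 0 < t) :
    IsURED (t • N) :=
  hN.of_mul_midpointDefect_le hNe (hNe.nnreal_smul ht) (c := t ^ 2) (by positivity) fun x y =>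
    (midpointDefect_smul t N x y).ge

theorem IsLUR.nnreal_smul (hN : IsLUR N) (hNe : IsEquivalentNorm N) {t : ℝ≥0} (ht : 0 < t) :
    IsLUR (t • N) :=
  hN.of_mul_midpointDefect_le hNe (hNe.nnreal_smul ht) (c := t ^ 2) (by positivity) fun x y =>
    (midpointDefect_smul t N x y).ge

theorem IsURED.sqAdd (hN : IsURED N) (hNe : IsEquivalentNorm N) (hp : IsEquivalentNorm p) :
    IsURED (sqAdd N p) :=
  hN.of_mul_midpointDefect_le hNe (hNe.sqAdd hp) one_pos fun x y =>
    (one_mul _).trans_le (midpointDefect_le_sqAdd_left N p x y)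

theorem IsLUR.sqAdd (hN : IsLUR N) (hNe : IsEquivalentNorm N) (hp : IsEquivalentNorm p) :
    IsLUR (sqAdd p N) :=
  hN.of_mul_midpointDefect_le hNe (hp.sqAdd hNe) one_pos fun x y =>
    (one_mul _).trans_le (midpointDefect_le_sqAdd_right p N x y)

theorem IsDenseClass.mono {S T : Set (Seminorm ℝ X)} (hS : IsDenseClass S) (h : S ⊆ T) :
    IsDenseClass T := fun p hp ε hε =>
  let ⟨q, hq, hpq⟩ := hS p hp ε hε
  ⟨q, h hq, hpq⟩

theorem IsDenseClass.nonempty {S : Set (Seminorm ℝ X)} (hS : IsDenseClass S)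
    (hp : IsEquivalentNorm p) : S.Nonempty :=
  let ⟨q, hq, _⟩ := hS p hp 1 one_pos
  ⟨q, hq⟩

end IsEquivalentNorm

section Biorthogonal

theorem not_finiteDimensional_ker {K E F : Type*} [DivisionRing K] [AddCommGroup E] [Module K E]
    [AddCommGroup F] [Module K F] [FiniteDimensional K F] (hdim : ¬ FiniteDimensional K E)
    (T : E →ₗ[K] F) : ¬ FiniteDimensional K (LinearMap.ker T) := fun _ => by
  have : FiniteDimensional K (E ⧸ LinearMap.ker T) :=
    Module.Finite.equiv T.quotKerEquivRange.symm
  exact hdim (Module.Finite.of_submodule_quotient (LinearMap.ker T))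

theorem exists_mem_infDist_ge {Z : Submodule ℝ X} (hZ : ¬ FiniteDimensional ℝ Z)
    (E : Submodule ℝ X) [FiniteDimensional ℝ E] :
    ∃ w ∈ Z, ‖w‖ ≤ 3 ∧ 1 / 4 ≤ Metric.infDist w E := by
  obtain ⟨g, hg, hsep⟩ := exists_seq_norm_le_one_le_norm_sub' (𝕜 := ℝ) (c := 2) (R := 3)
    (by norm_num) (by norm_num) hZ
  by_contra! H
  choose y hyE hy using fun n =>
    (Metric.infDist_lt_iff ⟨0, E.zero_mem⟩).1 (H (g n) (g n).2 (hg n))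
  have hyb : ∀ n, (⟨y n, hyE n⟩ : E) ∈ Metric.closedBall (0 : E) 4 := fun n => by
    rw [mem_closedBall_zero_iff, Submodule.coe_norm]
    have hgn : ‖(g n : X)‖ ≤ 3 := hg n
    have hyg : dist (y n) (g n) < 1 / 4 := dist_comm (y n) _ ▸ hy n
    linarith [norm_le_norm_add_norm_sub' (y n) (g n), dist_eq_norm (y n) (g n : X)]
  obtain ⟨_, -, ψ, hψ, hz⟩ := (isCompact_closedBall (0 : E) 4).tendsto_subseq hyb
  obtain ⟨k, hk⟩ := Metric.cauchySeq_iff.1 hz.cauchySeq (1 / 4) (by norm_num)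
  have hclose : dist (y (ψ k)) (y (ψ (k + 1))) < 1 / 4 := hk k le_rfl (k + 1) k.le_succ
  have hfar : 1 ≤ dist (g (ψ k) : X) (g (ψ (k + 1))) :=
    (hsep (hψ k.lt_succ_self).ne).trans_eq (dist_eq_norm _ _).symm
  have htri := dist_triangle4 (g (ψ k) : X) (y (ψ k)) (y (ψ (k + 1))) (g (ψ (k + 1)))
  rw [dist_comm (y (ψ (k + 1)))] at htri
  linarith [hy (ψ k), hy (ψ (k + 1))]

theorem exists_dual_eq_infDist (E : Submodule ℝ X) [IsClosed (E : Set X)] (w : X) :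
    ∃ φ : X →L[ℝ] ℝ, (∀ x, |φ x| ≤ ‖x‖) ∧ (∀ x ∈ E, φ x = 0) ∧ φ w = Metric.infDist w E := by
  obtain ⟨g, hg, hgw⟩ := exists_dual_vector'' ℝ (E.mkQ w)
  have hle : ∀ x, |g (E.mkQ x)| ≤ ‖x‖ := fun x =>
    (g.le_of_opNorm_le hg _).trans ((one_mul _).trans_le (Submodule.Quotient.norm_mk_le E x))
  refine ⟨(g.toLinearMap ∘ₗ E.mkQ).mkContinuous 1 fun x => by rw [one_mul]; exact hle x, hle,
    fun x hx => ?_, ?_⟩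
  · change g (E.mkQ x) = 0
    rw [Submodule.mkQ_apply, (Submodule.Quotient.mk_eq_zero E).2 hx, map_zero]
  · change g (E.mkQ w) = _
    rw [hgw]
    exact QuotientAddGroup.norm_mk w

theorem exists_dual_eq_seminorm {p : Seminorm ℝ X} (hp : Continuous p) {b : X} (hb : p b = 1) :
    ∃ B : X →L[ℝ] ℝ, B b = 1 ∧ ∀ x, |B x| ≤ p x := by
  have hb0 : b ≠ 0 := fun h => by simp [h] at hb
  let g := (LinearEquiv.toSpanNonzeroSingleton ℝ X b hb0).symm
  have hg : ∀ t : ℝ, ((g.symm t : Submodule.span ℝ {b}) : X) = t • b := fun _ => rfl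
  obtain ⟨B, hB, hBp⟩ := Module.Dual.exists_continuous_extension_of_le_seminorm_real
    (Submodule.span ℝ {b}) g.toLinearMap hp (fun x => by
      obtain ⟨t, rfl⟩ := g.symm.surjective x
      rw [hg, map_smul_eq_mul, hb, mul_one]
      simpa using le_abs_self t)
  refine ⟨B, ?_, hBp⟩
  have hBb := hB (g.symm 1)
  rw [hg, one_smul] at hBb
  simpa using hBb

theorem IsEquivalentNorm.exists_biorthogonal_pair (hdim : ¬ FiniteDimensional ℝ X)
    {p : Seminorm ℝ X} (hp : IsEquivalentNorm p) :
    ∃ C : ℝ≥0, ∀ (A : Finset X) (Φ : Finset (X →L[ℝ] ℝ)), ∃ (w : X) (φ : X →L[ℝ] ℝ),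
      p w ≤ C ∧ (∀ x, |φ x| ≤ p x) ∧ φ w = 1 ∧ (∀ a ∈ A, φ a = 0) ∧ ∀ g ∈ Φ, g w = 0 := by
  obtain ⟨α, β, hα, hβ, hαβ⟩ := hp
  refine ⟨Real.toNNReal (12 * β / α), fun A Φ => ?_⟩
  let T : X →ₗ[ℝ] Φ → ℝ := LinearMap.pi fun g => g.1.toLinearMap
  let E : Submodule ℝ X := Submodule.span ℝ (A : Set X)
  have : IsClosed (E : Set X) := E.closed_of_finiteDimensional
  obtain ⟨w, hwT, hw, hwE⟩ := exists_mem_infDist_ge (not_finiteDimensional_ker hdim T) E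
  obtain ⟨ψ, hψ, hψE, hψw⟩ := exists_dual_eq_infDist E w
  rw [← hψw] at hwE
  have hd : 0 < ψ w := by linarith
  refine ⟨(α * ψ w)⁻¹ • w, α • ψ, ?_, fun x => ?_, ?_, fun a ha => ?_, fun g hg => ?_⟩
  · have hpw : p w ≤ β * 3 := (hαβ w).2.trans (by gcongr)
    rw [Real.coe_toNNReal _ (by positivity), map_smul_eq_mul, norm_inv,
      Real.norm_of_nonneg (by positivity), inv_mul_le_iff₀ (by positivity), mul_right_comm,
      mul_div_cancel₀ _ hα.ne']
    nlinarith
  · rw [smul_apply, smul_eq_mul, abs_mul, abs_of_pos hα]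
    exact (by gcongr; exact hψ x : α * |ψ x| ≤ α * ‖x‖).trans (hαβ x).1
  · rw [smul_apply, map_smul, smul_eq_mul, smul_eq_mul, mul_left_comm,
      inv_mul_cancel₀ (mul_pos hα hd).ne']
  · rw [smul_apply, hψE a (Submodule.subset_span ha), smul_zero]
  · have hgw : g w = 0 := congrFun (LinearMap.mem_ker.1 hwT) ⟨g, hg⟩
    rw [map_smul, hgw, smul_zero]

/-- A functional `B` supporting the unit ball of `p` at `b`, and a bounded biorthogonal sequence
`(w n, φ n)` lying in the kernel of `B` and in the annihilator of `b`. -/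
structure BiorthogonalSystem (p : Seminorm ℝ X) where
  C : ℝ≥0
  b : X
  B : X →L[ℝ] ℝ
  w : ℕ → X
  φ : ℕ → X →L[ℝ] ℝ
  map_b : p b = 1
  B_b : B b = 1
  abs_B_le : ∀ x, |B x| ≤ p x
  map_w_le : ∀ n, p (w n) ≤ C
  B_w : ∀ n, B (w n) = 0
  φ_b : ∀ n, φ n b = 0
  abs_φ_le : ∀ n x, |φ n x| ≤ p x
  φ_w_self : ∀ n, φ n (w n) = 1
  φ_w_of_ne : ∀ {m n}, m ≠ n → φ m (w n) = 0

theorem IsEquivalentNorm.nonempty_biorthogonalSystem (hdim : ¬ FiniteDimensional ℝ X)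
    {p : Seminorm ℝ X} (hp : IsEquivalentNorm p) : Nonempty (BiorthogonalSystem p) := by
  classical
  have : Nontrivial X := not_subsingleton_iff_nontrivial.1 fun _ => hdim inferInstance
  obtain ⟨b, hb⟩ := hp.exists_eq_one
  obtain ⟨B, hBb, hBp⟩ := exists_dual_eq_seminorm hp.continuous hb
  obtain ⟨C, hC⟩ := hp.exists_biorthogonal_pair hdim
  obtain ⟨u, hu, horth⟩ := exists_seq_of_forall_finset_exists
    (fun u : X × (X →L[ℝ] ℝ) =>
      p u.1 ≤ C ∧ B u.1 = 0 ∧ u.2 b = 0 ∧ (∀ x, |u.2 x| ≤ p x) ∧ u.2 u.1 = 1)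
    (fun u u' => u.2 u'.1 = 0 ∧ u'.2 u.1 = 0) (by
      intro s _
      obtain ⟨w, φ, hw, hφ, hφw, hA, hΦ⟩ :=
        hC (insert b (s.image Prod.fst)) (insert B (s.image Prod.snd))
      rw [Finset.forall_mem_insert, Finset.forall_mem_image] at hA hΦ
      exact ⟨(w, φ), ⟨hw, hΦ.1, hA.1, hφ, hφw⟩, fun u hu => ⟨hΦ.2 hu, hA.2 hu⟩⟩)
  exact ⟨{
    C := C, b := b, B := B
    w := fun n => (u n).1
    φ := fun n => (u n).2
    map_b := hb
    B_b := hBb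
    abs_B_le := hBp
    map_w_le := fun n => (hu n).1
    B_w := fun n => (hu n).2.1
    φ_b := fun n => (hu n).2.2.1
    abs_φ_le := fun n => (hu n).2.2.2.1
    φ_w_self := fun n => (hu n).2.2.2.2
    φ_w_of_ne := fun {m n} h => h.lt_or_gt.elim (fun h => (horth m n h).1)
      fun h => (horth n m h).2 }⟩

theorem BiorthogonalSystem.one_le_C {p : Seminorm ℝ X} (s : BiorthogonalSystem p) : 1 ≤ s.C := by
  have h := (s.abs_φ_le 0 (s.w 0)).trans (s.map_w_le 0)
  rwa [s.φ_w_self, abs_one] at h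

end Biorthogonal

section WeightedL2

theorem sum_norm_rpow_two_le {a : ℕ → ℝ} {c : ℝ} (ha : ∀ j, |a j| ≤ (1 / 2) ^ j * c)
    (s : Finset ℕ) : ∑ j ∈ s, ‖a j‖ ^ (2 : ℝ) ≤ (2 * c) ^ (2 : ℝ) := by
  have hterm : ∀ j, ‖a j‖ ^ (2 : ℝ) ≤ (1 / 2) ^ j * c ^ 2 := fun j => by
    have hj : ((1 / 2 : ℝ) ^ j) ^ 2 ≤ (1 / 2) ^ j :=
      pow_le_of_le_one (by positivity) (pow_le_one₀ (by norm_num) (by norm_num)) two_ne_zero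
    rw [Real.rpow_two, Real.norm_eq_abs]
    calc |a j| ^ 2 ≤ ((1 / 2) ^ j * c) ^ 2 := by gcongr; exact ha j
      _ = ((1 / 2) ^ j) ^ 2 * c ^ 2 := mul_pow _ _ _
      _ ≤ (1 / 2) ^ j * c ^ 2 := by gcongr
  calc ∑ j ∈ s, ‖a j‖ ^ (2 : ℝ) ≤ (∑ j ∈ s, (1 / 2 : ℝ) ^ j) * c ^ 2 := by
        rw [Finset.sum_mul]
        exact Finset.sum_le_sum fun j _ => hterm j
    _ ≤ 2 * c ^ 2 := by
        gcongr
        exact (summable_geometric_two.sum_le_tsum s fun _ _ => by positivity).trans_eq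
          tsum_geometric_two
    _ ≤ (2 * c) ^ (2 : ℝ) := by
        rw [Real.rpow_two]
        nlinarith [sq_nonneg c]

variable {E : Type*} [AddCommGroup E] [Module ℝ E] {p : Seminorm ℝ E} {φ : ℕ → E →ₗ[ℝ] ℝ}
  (hφ : ∀ n x, |φ n x| ≤ p x)

include hφ in
theorem abs_geometric_mul_le (x : E) (j : ℕ) : |(1 / 2) ^ j * φ j x| ≤ (1 / 2) ^ j * p x := by
  rw [abs_mul, abs_of_pos (by positivity)]
  gcongr
  exact hφ j x

/-- The map `x ↦ (2⁻ʲ φⱼ(x))ⱼ` into `ℓ²` for a sequence of functionals dominated by `p`. -/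
noncomputable def weightedL2 : E →ₗ[ℝ] lp (fun _ : ℕ => ℝ) 2 where
  toFun x := ⟨fun j => (1 / 2) ^ j * φ j x,
    memℓp_gen' (C := (2 * p x) ^ (2 : ℝ)) (sum_norm_rpow_two_le (abs_geometric_mul_le hφ x))⟩
  map_add' x y := by
    ext j
    exact (congrArg _ (map_add (φ j) x y)).trans (mul_add _ _ _)
  map_smul' c x := by
    ext j
    exact (congrArg _ (map_smul (φ j) c x)).trans (mul_left_comm _ _ _)

theorem weightedL2_apply (x : E) (j : ℕ) : weightedL2 hφ x j = (1 / 2) ^ j * φ j x := rfl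

theorem norm_weightedL2_le (x : E) : ‖weightedL2 hφ x‖ ≤ 2 * p x :=
  lp.norm_le_of_forall_sum_le (by norm_num) (by positivity)
    (sum_norm_rpow_two_le (abs_geometric_mul_le hφ x))

theorem norm_weightedL2_of_forall_ne {x : E} {n : ℕ} (h : ∀ j ≠ n, φ j x = 0) :
    ‖weightedL2 hφ x‖ = (1 / 2) ^ n * |φ n x| := by
  have hsingle : weightedL2 hφ x = lp.single 2 n ((1 / 2) ^ n * φ n x) := by
    ext j
    rcases eq_or_ne j n with rfl | hj
    · rw [weightedL2_apply, lp.single_apply_self]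
    · rw [weightedL2_apply, h j hj, mul_zero, lp.single_apply_ne _ _ _ hj]
  rw [hsingle, lp.norm_single (by norm_num), norm_mul, Real.norm_of_nonneg (by positivity),
    Real.norm_eq_abs]

theorem apply_eq_zero_of_weightedL2_eq_zero {x : E} (h : weightedL2 hφ x = 0) (j : ℕ) :
    φ j x = 0 := by
  have hj : (1 / 2) ^ j * φ j x = 0 := by
    rw [← weightedL2_apply hφ, h]
    rfl
  exact (mul_eq_zero.1 hj).resolve_left (by positivity)

end WeightedL2

namespace BiorthogonalSystem

variable {p : Seminorm ℝ X} (s : BiorthogonalSystem p)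

/-- The `n`-th direction of a sequence on which `φ₀` is constant although every other functional of
the system eventually vanishes. -/
def v (n : ℕ) : X := s.w 0 + s.w (2 * n + 2)

theorem B_v (n : ℕ) : s.B (s.v n) = 0 := by rw [v, map_add, s.B_w, s.B_w, add_zero]

theorem φ_zero_v (n : ℕ) : s.φ 0 (s.v n) = 1 := by
  rw [v, map_add, s.φ_w_self, s.φ_w_of_ne (Nat.succ_ne_zero _).symm, add_zero]

theorem φ_v_self (n : ℕ) : s.φ (2 * n + 2) (s.v n) = 1 := by
  rw [v, map_add, s.φ_w_of_ne (Nat.succ_ne_zero _), s.φ_w_self, zero_add]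

theorem φ_v_of_ne {m n : ℕ} (hm : m ≠ 0) (h : m ≠ 2 * n + 2) : s.φ m (s.v n) = 0 := by
  rw [v, map_add, s.φ_w_of_ne hm, s.φ_w_of_ne h, add_zero]

theorem map_v_le (n : ℕ) : p (s.v n) ≤ 2 * s.C :=
  (map_add_le_add p _ _).trans (by linarith [s.map_w_le 0, s.map_w_le (2 * n + 2)])

/-- The projection onto the kernel of `φ (2 n + 2)` along `v n`. -/
def proj (n : ℕ) : X →ₗ[ℝ] X :=
  LinearMap.id - (s.φ (2 * n + 2)).toLinearMap.smulRight (s.v n)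

theorem proj_apply (n : ℕ) (x : X) : s.proj n x = x - s.φ (2 * n + 2) x • s.v n := rfl

theorem proj_v (n : ℕ) : s.proj n (s.v n) = 0 := by
  rw [proj_apply, s.φ_v_self, one_smul, sub_self]

theorem map_proj_le (n : ℕ) (x : X) : p (s.proj n x) ≤ 3 * s.C * p x := by
  have hC : (1 : ℝ) ≤ s.C := s.one_le_C
  have hφv : |s.φ (2 * n + 2) x| * p (s.v n) ≤ p x * (2 * s.C) := by
    gcongr
    exacts [s.abs_φ_le _ x, s.map_v_le n]
  have hsub := map_sub_le_add p x (s.φ (2 * n + 2) x • s.v n)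
  rw [map_smul_eq_mul, Real.norm_eq_abs] at hsub
  rw [proj_apply]
  nlinarith [apply_nonneg p x]

/-- The Hilbertian seminorm `x ↦ (∑ⱼ (2⁻ʲ φⱼ₊₁(x))²)^(1/2)`, which detects every functional of the
system other than `φ₀`. -/
noncomputable def T : Seminorm ℝ X :=
  (normSeminorm ℝ _).comp
    (weightedL2 (φ := fun j => (s.φ (j + 1)).toLinearMap) fun j x => s.abs_φ_le (j + 1) x)

theorem T_le (x : X) : s.T x ≤ 2 * p x := norm_weightedL2_le _ x

theorem T_v (n : ℕ) : s.T (s.v n) = (1 / 2) ^ (2 * n + 1) := by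
  refine (norm_weightedL2_of_forall_ne _ (n := 2 * n + 1) fun j hj => ?_).trans ?_
  · exact s.φ_v_of_ne j.succ_ne_zero fun h => hj (Nat.succ_injective h)
  · change _ * |s.φ (2 * n + 2) (s.v n)| = _
    rw [s.φ_v_self, abs_one, mul_one]

theorem midpointDefect_T (x y : X) : midpointDefect s.T x y = s.T (x - y) ^ 2 / 4 := by
  rw [T, midpointDefect_comp, midpointDefect_normSeminorm, ← map_sub]
  rfl

theorem proj_eq_self_of_T_eq_zero (n : ℕ) {x : X} (hx : s.T x = 0) : s.proj n x = x := by
  have hφ : s.φ (2 * n + 2) x = 0 :=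
    apply_eq_zero_of_weightedL2_eq_zero _ (norm_eq_zero.1 hx) (2 * n + 1)
  rw [proj_apply, hφ, zero_smul, sub_zero]

end BiorthogonalSystem

/-- The data of the construction of a norm close to `p`: a biorthogonal system for `p`, a parameter
`r` measuring the allowed distortion, and a bound making the norm `N`, which supplies the rotundity,
small compared with `p`; the constant `288` makes it equivalent to `8 C N ≤ κ p`. -/
structure RenormingData (p N : Seminorm ℝ X) extends BiorthogonalSystem p where
  r : ℝ≥0
  r_pos : 0 < r
  r_le_one : r ≤ 1
  N_le : ∀ x, 288 * (C : ℝ) ^ 2 * N x ≤ r ^ 2 * p x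

namespace RenormingData

variable {p N : Seminorm ℝ X} (D : RenormingData p N)

/-- The length of the perturbations that refute weak uniform rotundity. -/
noncomputable def h : ℝ≥0 := D.r / (2 * D.C)

/-- Half of the amount by which `F n` exceeds `1` at the point `z n`; see `F_z_self`. -/
noncomputable def μ : ℝ≥0 := D.r * D.h / 2

/-- The size of the rotund perturbations, small compared with `μ`. -/
noncomputable def κ : ℝ≥0 := D.μ / 9

theorem coe_r_pos : (0 : ℝ) < D.r := D.r_pos

theorem coe_r_le_one : (D.r : ℝ) ≤ 1 := D.r_le_one

theorem one_le_coe_C : (1 : ℝ) ≤ D.C := D.one_le_C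

theorem h_pos : (0 : ℝ) < D.h :=
  div_pos D.coe_r_pos (mul_pos two_pos (one_pos.trans_le D.one_le_coe_C))

theorem two_mul_h_mul_C : 2 * D.h * D.C = (D.r : ℝ) := by
  have hC := one_pos.trans_le D.one_le_coe_C
  rw [h, NNReal.coe_div, NNReal.coe_mul, NNReal.coe_ofNat]
  field_simp

theorem h_le : (D.h : ℝ) ≤ D.r / 2 := by
  nlinarith [D.two_mul_h_mul_C, D.one_le_coe_C, D.h_pos]

theorem two_mul_μ : 2 * D.μ = (D.r * D.h : ℝ) := by
  rw [μ, NNReal.coe_div, NNReal.coe_mul, NNReal.coe_ofNat]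
  ring

theorem μ_pos : (0 : ℝ) < D.μ := by
  nlinarith [D.two_mul_μ, mul_pos D.coe_r_pos D.h_pos]

theorem μ_le : (D.μ : ℝ) ≤ D.r / 4 := by
  nlinarith [D.two_mul_μ, D.h_le, D.coe_r_le_one, D.h_pos]

theorem nine_mul_κ : 9 * D.κ = (D.μ : ℝ) := by
  rw [κ, NNReal.coe_div, NNReal.coe_ofNat]
  ring

theorem κ_pos : (0 : ℝ) < D.κ := by linarith [D.nine_mul_κ, D.μ_pos]

theorem κ_le : (D.κ : ℝ) ≤ D.r / 36 := by linarith [D.nine_mul_κ, D.μ_le]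

theorem mul_N_le (x : X) : 8 * D.C * N x ≤ D.κ * p x := by
  have hC := one_pos.trans_le D.one_le_coe_C
  have hκ : 36 * D.C * D.κ = (D.r : ℝ) ^ 2 := by
    linear_combination 4 * D.C * D.nine_mul_κ + 2 * D.C * D.two_mul_μ + D.r * D.two_mul_h_mul_C
  refine le_of_mul_le_mul_left ?_ (mul_pos (by norm_num : (0 : ℝ) < 36) hC)
  linear_combination D.N_le x - p x * hκ

theorem N_le_κ_mul (x : X) : N x ≤ D.κ / 8 * p x := by
  nlinarith [D.mul_N_le x, D.one_le_coe_C, apply_nonneg N x]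

/-- A small perturbation of the supporting functional `B`; only odd indices are used, the even ones
serving for the directions `v n`. -/
noncomputable def F (n : ℕ) : X →ₗ[ℝ] ℝ :=
  D.B.toLinearMap + (D.r : ℝ) • (D.φ (2 * n + 1)).toLinearMap

theorem F_apply (n : ℕ) (x : X) : D.F n x = D.B x + D.r * D.φ (2 * n + 1) x := rfl

/-- The seminorm `x ↦ |F n x|`. -/
noncomputable def absF (n : ℕ) : Seminorm ℝ X := (normSeminorm ℝ ℝ).comp (D.F n)

theorem absF_apply (n : ℕ) (x : X) : D.absF n x = |D.F n x| := rfl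

theorem absF_le (n : ℕ) (x : X) : D.absF n x ≤ (1 + D.r) * p x := by
  rw [absF_apply, F_apply, add_mul, one_mul]
  refine (abs_add_le _ _).trans ?_
  rw [abs_mul, NNReal.abs_eq]
  gcongr
  exacts [D.abs_B_le x, D.abs_φ_le _ x]

theorem isBoundedUnder_absF (x : X) : IsBoundedUnder (· ≤ ·) atTop fun n => D.absF n x :=
  isBoundedUnder_of ⟨_, fun n => D.absF_le n x⟩

/-- The main part of `G none`, close to `p`. Its second term prevents the functionals `F n` with
large `n` from being almost norming at a fixed point. -/
noncomputable def base : Seminorm ℝ X :=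
  (1 + 2 * D.r)⁻¹ • p ⊔ (1 + D.μ) • limsupSeminorm D.absF D.isBoundedUnder_absF

theorem base_apply (x : X) : D.base x = max ((1 + 2 * D.r : ℝ)⁻¹ * p x)
    ((1 + D.μ) * limsupSeminorm D.absF D.isBoundedUnder_absF x) := by
  rw [base, Seminorm.sup_apply, nnreal_smul_apply, nnreal_smul_apply]
  push_cast
  rfl

theorem base_le (x : X) : D.base x ≤ (1 + D.r) ^ 2 * p x := by
  have hr := D.coe_r_pos
  have hμ := D.μ_le
  have hinv : (1 + 2 * D.r : ℝ)⁻¹ ≤ (1 + D.r) ^ 2 :=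
    (inv_le_one_of_one_le₀ (by linarith)).trans (one_le_pow₀ (by linarith))
  rw [base_apply, pow_two, mul_assoc]
  refine max_le ?_ (mul_le_mul (by linarith)
    (limsupSeminorm_le _ (.of_forall fun n => D.absF_le n x)) (apply_nonneg _ _) (by positivity))
  rw [← mul_assoc, ← pow_two]
  gcongr

/-- The rotund perturbation of `absF n`. Only the last two terms see the direction `v n`, and they
are small there. -/
noncomputable def rest (n : ℕ) : Seminorm ℝ X :=
  sqAdd (N.comp (D.proj n)) (sqAdd ((D.κ / 4) • D.T) ((n + 1 : ℝ≥0)⁻¹ • N))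

theorem rest_le_add (n : ℕ) (x : X) :
    D.rest n x ≤ N (D.proj n x) + (D.κ / 4 * D.T x + (n + 1 : ℝ)⁻¹ * N x) := by
  refine (sqAdd_le_add _ _ x).trans (add_le_add_right ((sqAdd_le_add _ _ x).trans_eq ?_) _)
  rw [nnreal_smul_apply, nnreal_smul_apply]
  push_cast
  rfl

theorem N_proj_le (n : ℕ) (x : X) : N (D.proj n x) ≤ 3 * D.κ / 8 * p x := by
  have hC := one_pos.trans_le D.one_le_coe_C
  have hproj : D.κ * p (D.proj n x) ≤ D.κ * (3 * D.C * p x) := by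
    gcongr
    exact D.map_proj_le n x
  nlinarith [D.mul_N_le (D.proj n x)]

theorem rest_le (n : ℕ) (x : X) : D.rest n x ≤ D.κ * p x := by
  have hT : D.κ / 4 * D.T x ≤ D.κ / 4 * (2 * p x) := by
    gcongr
    exact D.T_le x
  have hN : (n + 1 : ℝ)⁻¹ * N x ≤ N x :=
    mul_le_of_le_one_left (apply_nonneg _ _) (inv_le_one_of_one_le₀ (by norm_cast; omega))
  linarith [D.rest_le_add n x, D.N_proj_le n x, D.N_le_κ_mul x]

/-- The family of seminorms whose supremum is the new norm. -/
noncomputable def G : Option ℕ → Seminorm ℝ X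
  | none => sqAdd D.base N
  | some n => sqAdd (D.absF n) (D.rest n)

theorem G_none_le (x : X) : D.G none x ≤ D.base x + N x := sqAdd_le_add _ _ x

theorem G_some_le (n : ℕ) (x : X) : D.G (some n) x ≤ |D.F n x| + D.rest n x := sqAdd_le_add _ _ x

theorem G_le (i : Option ℕ) (x : X) : D.G i x ≤ (1 + 4 * D.r) * p x := by
  have hr := D.coe_r_le_one
  have hκ : D.κ * p x ≤ D.r / 36 * p x := by
    gcongr
    exact D.κ_le
  have hr2 : (D.r : ℝ) ^ 2 * p x ≤ D.r * p x := by
    gcongr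
    exact pow_le_of_le_one D.r.coe_nonneg hr two_ne_zero
  have hrp : 0 ≤ D.r * p x := by positivity
  rcases i with - | n
  · linarith [D.G_none_le x, D.base_le x, D.N_le_κ_mul x]
  · linarith [D.G_some_le n x, D.absF_le n x, D.absF_apply n x, D.rest_le n x]

theorem bddAbove_range_G : BddAbove (Set.range D.G) :=
  ⟨(1 + 4 * D.r) • p, Set.forall_mem_range.2 fun i x => D.G_le i x⟩

/-- The new norm. -/
noncomputable def q : Seminorm ℝ X := ⨆ i, D.G i

theorem G_le_q (i : Option ℕ) (x : X) : D.G i x ≤ D.q x := le_iSup_apply D.bddAbove_range_G i x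

theorem q_le (x : X) : D.q x ≤ (1 + 4 * D.r) * p x :=
  iSup_apply_le D.bddAbove_range_G fun i => D.G_le i x

theorem base_le_q (x : X) : D.base x ≤ D.q x := (le_sqAdd_left _ _ x).trans (D.G_le_q none x)

theorem le_q (x : X) : p x ≤ (1 + 2 * D.r) * D.q x := by
  have hr := D.coe_r_pos
  rw [← inv_mul_le_iff₀ (by positivity)]
  exact (le_max_left _ _).trans ((D.base_apply x).ge.trans (D.base_le_q x))

theorem le_three_mul_q (x : X) : p x ≤ 3 * D.q x :=
  (D.le_q x).trans (by gcongr; linarith [D.coe_r_le_one])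

theorem isEquivalentNorm_q (hp : IsEquivalentNorm p) : IsEquivalentNorm D.q :=
  hp.of_le_mul (by positivity) three_pos D.q_le D.le_three_mul_q

theorem midpointDefect_le_G_none (x y : X) : midpointDefect N x y ≤ midpointDefect (D.G none) x y :=
  midpointDefect_le_sqAdd_right _ _ x y

theorem midpointDefect_proj_le_G_some (n : ℕ) (x y : X) :
    midpointDefect N (D.proj n x) (D.proj n y) ≤ midpointDefect (D.G (some n)) x y := by
  rw [← midpointDefect_comp]
  exact (midpointDefect_le_sqAdd_left _ _ x y).trans (midpointDefect_le_sqAdd_right _ _ x y)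

theorem sq_mul_T_sub_le_G_some (n : ℕ) (x y : X) :
    (D.κ / 8 * D.T (x - y)) ^ 2 ≤ midpointDefect (D.G (some n)) x y := by
  calc (D.κ / 8 * D.T (x - y)) ^ 2 = midpointDefect ((D.κ / 4) • D.T) x y := by
        rw [midpointDefect_smul, D.midpointDefect_T]
        push_cast
        ring
    _ ≤ midpointDefect (D.rest n) x y :=
        (midpointDefect_le_sqAdd_left _ _ x y).trans (midpointDefect_le_sqAdd_right _ _ x y)
    _ ≤ midpointDefect (D.G (some n)) x y := midpointDefect_le_sqAdd_right _ _ x y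

theorem sq_inv_mul_midpointDefect_le_G_some (n : ℕ) (x y : X) :
    ((n + 1 : ℝ)⁻¹) ^ 2 * midpointDefect N x y ≤ midpointDefect (D.G (some n)) x y := by
  calc ((n + 1 : ℝ)⁻¹) ^ 2 * midpointDefect N x y
      = midpointDefect ((n + 1 : ℝ≥0)⁻¹ • N) x y := by
        rw [midpointDefect_smul]
        push_cast
        rfl
    _ ≤ midpointDefect (D.rest n) x y :=
        (midpointDefect_le_sqAdd_right _ _ x y).trans (midpointDefect_le_sqAdd_right _ _ x y)
    _ ≤ midpointDefect (D.G (some n)) x y := midpointDefect_le_sqAdd_right _ _ x y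

theorem N_le_one {x : X} (hx : D.q x ≤ 1) : N x ≤ 1 := by
  nlinarith [D.N_le_κ_mul x, D.le_three_mul_q x, D.κ_le, D.coe_r_le_one, D.κ_pos]

theorem N_proj_le_one (n : ℕ) {x : X} (hx : D.q x ≤ 1) : N (D.proj n x) ≤ 1 := by
  nlinarith [D.N_proj_le n x, D.le_three_mul_q x, D.κ_le, D.coe_r_le_one, D.κ_pos]

theorem abs_lt_of_midpointDefect_G_some_lt {n : ℕ} {x y v : X} {c ε : ℝ} (hv : D.T v ≠ 0)
    (hε : 0 < ε) (hxy : y - x = c • v)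
    (hD : midpointDefect (D.G (some n)) x y < (D.κ / 8 * D.T v * ε) ^ 2) : |c| < ε := by
  have hpos : 0 < D.κ / 8 * D.T v :=
    mul_pos (div_pos D.κ_pos (by norm_num)) ((apply_nonneg D.T v).lt_of_ne' hv)
  have hT : D.T (x - y) = |c| * D.T v := by
    rw [map_sub_rev, hxy, map_smul_eq_mul, Real.norm_eq_abs]
  have hlt :=
    lt_of_pow_lt_pow_left₀ 2 (by positivity) ((D.sq_mul_T_sub_le_G_some n x y).trans_lt hD)
  rw [hT, mul_left_comm, mul_comm] at hlt
  exact lt_of_mul_lt_mul_left hlt hpos.le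

theorem isURED_q (hN : IsURED N) (hNe : IsEquivalentNorm N) : IsURED D.q := by
  refine isURED_iSup D.bddAbove_range_G fun v (hv : D.q v = 1) ε hε => ?_
  have hNv : N v ≠ 0 := fun h0 => by simp [hNe.eq_zero h0] at hv
  obtain ⟨δ, hδ, H⟩ := hN.exists_midpointDefect hNv hε one_pos
  have hnone : ∀ {x y : X} {c : ℝ}, D.q x ≤ 1 → D.q y ≤ 1 → y - x = c • v →
      midpointDefect (D.G none) x y < δ → |c| < ε := fun {x y c} hx hy hxy hD =>
    H x y c (D.N_le_one hx) (D.N_le_one hy) hxy ((D.midpointDefect_le_G_none x y).trans_lt hD)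
  by_cases hT : D.T v = 0
  · refine ⟨δ, hδ, fun i x y c hx hy hxy hD => ?_⟩
    rcases i with - | n
    · exact hnone hx hy hxy hD
    · refine H (D.proj n x) (D.proj n y) c (D.N_proj_le_one n hx) (D.N_proj_le_one n hy) ?_
        ((D.midpointDefect_proj_le_G_some n x y).trans_lt hD)
      rw [← map_sub, hxy, map_smul, D.proj_eq_self_of_T_eq_zero n hT]
  · have hpos : D.κ / 8 * D.T v * ε ≠ 0 :=
      mul_ne_zero (mul_ne_zero (div_ne_zero D.κ_pos.ne' (by norm_num)) hT) hε.ne'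
    refine ⟨min δ ((D.κ / 8 * D.T v * ε) ^ 2), lt_min hδ (by positivity),
      fun i x y c hx hy hxy hD => ?_⟩
    rcases i with - | n
    · exact hnone hx hy hxy (hD.trans_le (min_le_left _ _))
    · exact D.abs_lt_of_midpointDefect_G_some_lt hT hε hxy (hD.trans_le (min_le_right _ _))

theorem exists_forall_G_some_le {x : X} (hx : D.q x = 1) :
    ∃ k, ∀ n ≥ k, D.G (some n) x ≤ 1 - D.μ / 6 := by
  have hμ := D.μ_pos
  have hlimsup : limsupSeminorm D.absF D.isBoundedUnder_absF x < 1 - D.μ / 2 := by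
    have hbase : (1 + D.μ) * limsupSeminorm D.absF D.isBoundedUnder_absF x ≤ 1 :=
      (le_max_right _ _).trans ((D.base_apply x).ge.trans ((D.base_le_q x).trans_eq hx))
    nlinarith [D.μ_le, D.coe_r_le_one]
  refine eventually_atTop.1 ((eventually_lt_of_limsupSeminorm_lt _ hlimsup).mono fun n hn => ?_)
  have hrest : D.rest n x ≤ D.μ / 3 := by
    nlinarith [D.rest_le n x, D.le_three_mul_q x, D.nine_mul_κ, D.κ_pos]
  rw [absF_apply] at hn
  linarith [D.G_some_le n x]

theorem isLUR_q (hN : IsLUR N) (hNe : IsEquivalentNorm N) (hp : IsEquivalentNorm p) :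
    IsLUR D.q := by
  refine isLUR_iSup D.bddAbove_range_G fun x (hx : D.q x = 1) ε hε => ?_
  obtain ⟨M, hM, hle⟩ := hNe.exists_le_mul (D.isEquivalentNorm_q hp)
  obtain ⟨δ, hδ, H⟩ := hN.exists_midpointDefect x (div_pos hε hM)
  obtain ⟨k, hk⟩ := D.exists_forall_G_some_le hx
  have hμ := D.μ_pos
  refine ⟨min (D.μ / 12) (((k + 1 : ℝ)⁻¹) ^ 2 * δ), by positivity, fun i y hi hD => ?_⟩
  obtain ⟨hgap, -⟩ := lt_min_iff.1 hi
  obtain ⟨-, hdefect⟩ := lt_min_iff.1 hD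
  refine (hle _).trans_lt ((lt_div_iff₀' hM).1 (H y ?_))
  rcases i with - | n
  · refine (D.midpointDefect_le_G_none x y).trans_lt (hdefect.trans_le ?_)
    exact mul_le_of_le_one_left hδ.le
      (pow_le_one₀ (by positivity) (inv_le_one_of_one_le₀ (by norm_cast; omega)))
  · have hnk : n < k := by
      by_contra! hkn
      rw [show (⨆ j, D.G j) x = 1 from hx] at hgap
      nlinarith [hk n hkn, apply_nonneg (D.G (some n)) x]
    refine lt_of_mul_lt_mul_left (((D.sq_inv_mul_midpointDefect_le_G_some n x y).trans_lt
      hdefect).trans_le ?_) (by positivity)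
    gcongr

/-- Points at which `F n` is the dominating functional. -/
noncomputable def z (n : ℕ) : X := D.b + (D.h : ℝ) • D.w (2 * n + 1)

/-- Perturbations of fixed size that change `q` at `z n` by a null sequence only. -/
noncomputable def u (n : ℕ) : X := (D.h : ℝ) • D.v n

theorem F_z (m n : ℕ) : D.F m (D.z n) = 1 + D.r * D.h * D.φ (2 * m + 1) (D.w (2 * n + 1)) := by
  simp only [F_apply, z, map_add, map_smul, smul_eq_mul, D.B_b, D.B_w, D.φ_b]
  ring

theorem F_z_self (n : ℕ) : D.F n (D.z n) = 1 + 2 * D.μ := by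
  rw [F_z, D.φ_w_self, mul_one, two_mul_μ]

theorem F_z_of_ne {m n : ℕ} (hmn : m ≠ n) : D.F m (D.z n) = 1 := by
  rw [F_z, D.φ_w_of_ne (by omega), mul_zero, add_zero]

theorem F_u (m n : ℕ) : D.F m (D.u n) = 0 := by
  rw [u, map_smul, F_apply, D.B_v, D.φ_v_of_ne (by omega) (by omega), mul_zero, add_zero, smul_zero]

theorem map_z_le (n : ℕ) : p (D.z n) ≤ 1 + D.r / 2 := by
  have hw : D.h * p (D.w (2 * n + 1)) ≤ D.h * D.C := by
    gcongr
    exact D.map_w_le _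
  refine (map_add_le_add p _ _).trans ?_
  rw [D.map_b, map_smul_eq_mul, NNReal.norm_eq]
  linarith [D.two_mul_h_mul_C]

theorem map_u_le (n : ℕ) : p (D.u n) ≤ D.r := by
  have hv : D.h * p (D.v n) ≤ D.h * (2 * D.C) := by
    gcongr
    exact D.map_v_le n
  rw [u, map_smul_eq_mul, NNReal.norm_eq]
  linarith [D.two_mul_h_mul_C]

theorem one_add_two_mul_μ_le_q_z (n : ℕ) : 1 + 2 * D.μ ≤ D.q (D.z n) := by
  rw [← F_z_self]
  exact (le_abs_self _).trans ((le_sqAdd_left _ _ _).trans (D.G_le_q (some n) _))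

theorem G_some_u_le (n : ℕ) : D.G (some n) (D.u n) ≤ (1 / 2) ^ n + ((n : ℝ) + 1)⁻¹ := by
  have hh : (D.h : ℝ) ≤ 1 := by linarith [D.h_le, D.coe_r_le_one]
  have hκ : (D.κ : ℝ) ≤ 1 := by linarith [D.κ_le, D.coe_r_le_one]
  have hproj : D.proj n (D.u n) = 0 := by rw [u, map_smul, D.proj_v, smul_zero]
  have hT : D.T (D.u n) ≤ (1 / 2) ^ n := by
    rw [u, map_smul_eq_mul, NNReal.norm_eq, D.T_v]
    exact (mul_le_of_le_one_left (by positivity) hh).trans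
      (pow_le_pow_of_le_one (by norm_num) (by norm_num) (by omega))
  have hN : N (D.u n) ≤ 1 := by
    nlinarith [D.N_le_κ_mul (D.u n), D.map_u_le n, D.coe_r_le_one, apply_nonneg p (D.u n)]
  have hsum := (D.G_some_le n (D.u n)).trans (add_le_add_right (D.rest_le_add n (D.u n)) _)
  rw [F_u, abs_zero, zero_add, hproj, map_zero, zero_add] at hsum
  refine hsum.trans (add_le_add ?_ (mul_le_of_le_one_right (by positivity) hN))
  exact (mul_le_of_le_one_left (apply_nonneg _ _) (by linarith)).trans hT

theorem F_z_add_smul_u (σ : ℝ) (m n : ℕ) : D.F m (D.z n + σ • D.u n) = D.F m (D.z n) := by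
  rw [map_add, map_smul, F_u, smul_zero, add_zero]

section Perturbation

variable {σ : ℝ} (hσ : |σ| = 1) (n : ℕ)
include hσ

theorem map_z_add_smul_u_le : p (D.z n + σ • D.u n) ≤ 1 + 2 * D.r := by
  have hadd := map_add_le_add p (D.z n) (σ • D.u n)
  rw [map_smul_eq_mul, Real.norm_eq_abs, hσ, one_mul] at hadd
  linarith [D.map_z_le n, D.map_u_le n, D.r.coe_nonneg]

theorem base_z_add_smul_u_le : D.base (D.z n + σ • D.u n) ≤ 1 + D.μ := by
  have hlimsup : limsupSeminorm D.absF D.isBoundedUnder_absF (D.z n + σ • D.u n) ≤ 1 := by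
    refine limsupSeminorm_le _ ((eventually_gt_atTop n).mono fun m hm => ?_)
    rw [absF_apply, F_z_add_smul_u, D.F_z_of_ne hm.ne', abs_one]
  rw [base_apply]
  refine max_le ?_ (mul_le_of_le_one_right (by positivity) hlimsup)
  rw [inv_mul_le_iff₀ (by positivity)]
  nlinarith [D.map_z_add_smul_u_le hσ n, D.μ_pos, D.coe_r_pos]

theorem q_z_add_smul_u_le :
    D.q (D.z n + σ • D.u n) ≤ D.q (D.z n) + ((1 / 2) ^ n + ((n : ℝ) + 1)⁻¹) := by
  have hμ := D.μ_pos
  have hκ := D.nine_mul_κ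
  have hz := D.one_add_two_mul_μ_le_q_z n
  have hη : (0 : ℝ) ≤ (1 / 2) ^ n + ((n : ℝ) + 1)⁻¹ := by positivity
  have hκp : D.κ * p (D.z n + σ • D.u n) ≤ D.κ * 3 := by
    gcongr
    exact (D.map_z_add_smul_u_le hσ n).trans (by linarith [D.coe_r_le_one])
  refine iSup_apply_le D.bddAbove_range_G fun i => ?_
  rcases i with - | m
  · linarith [D.G_none_le (D.z n + σ • D.u n), D.base_z_add_smul_u_le hσ n,
      D.N_le_κ_mul (D.z n + σ • D.u n)]
  rcases eq_or_ne m n with rfl | hmn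
  · have hadd := map_add_le_add (D.G (some m)) (D.z m) (σ • D.u m)
    rw [map_smul_eq_mul, Real.norm_eq_abs, hσ, one_mul] at hadd
    linarith [D.G_le_q (some m) (D.z m), D.G_some_u_le m]
  · have hG := D.G_some_le m (D.z n + σ • D.u n)
    rw [F_z_add_smul_u, D.F_z_of_ne hmn, abs_one] at hG
    linarith [D.rest_le m (D.z n + σ • D.u n)]

end Perturbation

theorem not_isWUR_q : ¬ IsWUR D.q := by
  intro hq
  have hz : ∀ n, D.q (D.z n) ≤ 5 * 2 := fun n => by
    refine (D.q_le _).trans (mul_le_mul ?_ ((D.map_z_le n).trans ?_) (apply_nonneg _ _) ?_) <;>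
      linarith [D.coe_r_le_one]
  have hη : Tendsto (fun n : ℕ => (1 / 2 : ℝ) ^ n + ((n : ℝ) + 1)⁻¹) atTop (𝓝 0) := by
    simpa only [one_div, add_zero] using (tendsto_pow_atTop_nhds_zero_of_lt_one
      (by norm_num) (by norm_num : (1 / 2 : ℝ) < 1)).add tendsto_one_div_add_atTop_nhds_zero_nat
  have hlim : Tendsto (fun n => D.φ 0 (D.u n)) atTop (𝓝 0) := by
    refine hq.tendsto_apply_of_map_add_le (fun n => ?_) hz hη (fun n => ?_) (fun n => ?_) (D.φ 0)
    · linarith [D.one_add_two_mul_μ_le_q_z n, D.μ_pos]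
    · simpa only [one_smul] using D.q_z_add_smul_u_le abs_one n
    · simpa only [neg_smul, one_smul, ← sub_eq_add_neg] using
        D.q_z_add_smul_u_le (σ := -1) (by simp) n
  have hφu : ∀ n, D.φ 0 (D.u n) = D.h := fun n => by
    rw [u, map_smul, D.φ_zero_v, smul_eq_mul, mul_one]
  simp only [hφu] at hlim
  exact D.h_pos.ne' (tendsto_nhds_unique tendsto_const_nhds hlim)

end RenormingData

theorem IsEquivalentNorm.exists_renormingData (hdim : ¬ FiniteDimensional ℝ X)
    {p N : Seminorm ℝ X} (hp : IsEquivalentNorm p) (hN : IsEquivalentNorm N) {r : ℝ≥0}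
    (hr : 0 < r) (hr1 : r ≤ 1) :
    ∃ (t : ℝ≥0) (D : RenormingData p (t • N)), 0 < t ∧ D.r = r := by
  obtain ⟨s⟩ := hp.nonempty_biorthogonalSystem hdim
  obtain ⟨M, hM, hle⟩ := hp.exists_le_mul hN
  have hC : (0 : ℝ) < s.C := one_pos.trans_le s.one_le_C
  have hpos : 0 < (r : ℝ) ^ 2 / (288 * s.C ^ 2 * M) := by positivity
  refine ⟨Real.toNNReal (r ^ 2 / (288 * s.C ^ 2 * M)), ⟨s, r, hr, hr1, fun x => ?_⟩,
    Real.toNNReal_pos.2 hpos, rfl⟩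
  rw [nnreal_smul_apply, Real.coe_toNNReal _ hpos.le]
  calc 288 * (s.C : ℝ) ^ 2 * (r ^ 2 / (288 * s.C ^ 2 * M) * N x)
      = r ^ 2 * (M⁻¹ * N x) := by field_simp
    _ ≤ r ^ 2 * p x := by
      gcongr
      rw [inv_mul_le_iff₀ hM]
      exact hle x

theorem exists_isURED_not_isWUR_le_mul (hdim : ¬ FiniteDimensional ℝ X) {p N : Seminorm ℝ X}
    (hp : IsEquivalentNorm p) (hNe : IsEquivalentNorm N) (hN : IsURED N) {r : ℝ≥0} (hr : 0 < r)
    (hr1 : r ≤ 1) :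
    ∃ q : Seminorm ℝ X, (IsEquivalentNorm q ∧ IsURED q ∧ ¬ IsWUR q ∧ (IsLUR N → IsLUR q)) ∧
      ∀ x, q x ≤ (1 + 4 * r) * p x ∧ p x ≤ (1 + 2 * r) * q x := by
  obtain ⟨t, D, ht, rfl⟩ := hp.exists_renormingData hdim hNe hr hr1
  exact ⟨D.q, ⟨D.isEquivalentNorm_q hp, D.isURED_q (hN.nnreal_smul hNe ht) (hNe.nnreal_smul ht),
    D.not_isWUR_q, fun hL => D.isLUR_q (hL.nnreal_smul hNe ht) (hNe.nnreal_smul ht) hp⟩,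
    fun x => ⟨D.q_le x, D.le_q x⟩⟩

theorem isDenseClass_of_isURED (hdim : ¬ FiniteDimensional ℝ X) {N : Seminorm ℝ X}
    (hNe : IsEquivalentNorm N) (hN : IsURED N) :
    IsDenseClass {q : Seminorm ℝ X |
      IsEquivalentNorm q ∧ IsURED q ∧ ¬ IsWUR q ∧ (IsLUR N → IsLUR q)} := by
  intro p hp ε hε
  obtain ⟨r, hr, hr1, hrε⟩ : ∃ r : ℝ≥0, 0 < r ∧ (r : ℝ) ≤ 1 ∧ 14 * (r : ℝ) ≤ ε := by
    refine ⟨min 1 (Real.toNNReal (ε / 14)), lt_min one_pos (Real.toNNReal_pos.2 (by positivity)),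
      min_le_left _ _, ?_⟩
    rw [NNReal.coe_min, Real.coe_toNNReal _ (by positivity)]
    linarith [min_le_right ((1 : ℝ≥0) : ℝ) (ε / 14)]
  obtain ⟨q, hq, hqp⟩ :=
    exists_isURED_not_isWUR_le_mul hdim (hp.nnreal_smul (t := (1 + 4 * r)⁻¹) (by positivity)) hNe hN
      hr hr1
  have hscale : ∀ x, (1 + 4 * (r : ℝ)) * ((1 + 4 * r)⁻¹ • p) x = p x := fun x => by
    rw [nnreal_smul_apply]
    push_cast
    exact mul_inv_cancel_left₀ (by positivity) _
  refine ⟨q, hq, fun x => ⟨(hqp x).1.trans_eq (hscale x), ?_⟩⟩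
  calc p x = (1 + 4 * (r : ℝ)) * ((1 + 4 * r)⁻¹ • p) x := (hscale x).symm
    _ ≤ (1 + 4 * r) * ((1 + 2 * r) * q x) := by
      gcongr
      exact (hqp x).2
    _ = (1 + 4 * r) * (1 + 2 * r) * q x := (mul_assoc _ _ _).symm
    _ ≤ (1 + ε) * q x := by
      gcongr
      nlinarith [r.coe_nonneg]

end Renorming

theorem theoremB_general {X : Type*} [NormedAddCommGroup X] [NormedSpace ℝ X]
    (hdim : ¬ FiniteDimensional ℝ X)
    (hURED : ∃ p : Seminorm ℝ X, Renorming.IsEquivalentNorm p ∧ Renorming.IsURED p) :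
    ((∃ p : Seminorm ℝ X, Renorming.IsEquivalentNorm p ∧
        Renorming.IsURED p ∧ ¬ Renorming.IsWUR p) ∧
      Renorming.IsDenseClass {p : Seminorm ℝ X | Renorming.IsEquivalentNorm p ∧
        Renorming.IsURED p ∧ ¬ Renorming.IsWUR p}) ∧
    ((∃ p : Seminorm ℝ X, Renorming.IsEquivalentNorm p ∧ Renorming.IsLUR p) →
      (∃ p : Seminorm ℝ X, Renorming.IsEquivalentNorm p ∧
        Renorming.IsURED p ∧ ¬ Renorming.IsWUR p ∧ Renorming.IsLUR p) ∧
      Renorming.IsDenseClass {p : Seminorm ℝ X | Renorming.IsEquivalentNorm p ∧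
        Renorming.IsURED p ∧ ¬ Renorming.IsWUR p ∧ Renorming.IsLUR p}) := by
  obtain ⟨u, hue, hu⟩ := hURED
  have hdense : Renorming.IsDenseClass {p : Seminorm ℝ X | Renorming.IsEquivalentNorm p ∧
      Renorming.IsURED p ∧ ¬ Renorming.IsWUR p} :=
    (Renorming.isDenseClass_of_isURED hdim hue hu).mono fun q hq => ⟨hq.1, hq.2.1, hq.2.2.1⟩
  refine ⟨⟨hdense.nonempty hue, hdense⟩, ?_⟩
  rintro ⟨l, hle, hl⟩
  have hdenseLUR : Renorming.IsDenseClass {p : Seminorm ℝ X | Renorming.IsEquivalentNorm p ∧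
      Renorming.IsURED p ∧ ¬ Renorming.IsWUR p ∧ Renorming.IsLUR p} :=
    (Renorming.isDenseClass_of_isURED hdim (hue.sqAdd hle) (hu.sqAdd hue hle)).mono fun q hq =>
      ⟨hq.1, hq.2.1, hq.2.2.1, hq.2.2.2 (hl.sqAdd hle hue)⟩
  exact ⟨hdenseLUR.nonempty hue, hdenseLUR⟩

theorem theoremB {X : Type*} [NormedAddCommGroup X] [NormedSpace ℝ X] [CompleteSpace X]
    (hdim : ¬ FiniteDimensional ℝ X)
    (hURED : ∃ p : Seminorm ℝ X, Renorming.IsEquivalentNorm p ∧ Renorming.IsURED p) :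
    ((∃ p : Seminorm ℝ X, Renorming.IsEquivalentNorm p ∧
        Renorming.IsURED p ∧ ¬ Renorming.IsWUR p) ∧
      Renorming.IsDenseClass {p : Seminorm ℝ X | Renorming.IsEquivalentNorm p ∧
        Renorming.IsURED p ∧ ¬ Renorming.IsWUR p}) ∧
    ((∃ p : Seminorm ℝ X, Renorming.IsEquivalentNorm p ∧ Renorming.IsLUR p) →
      (∃ p : Seminorm ℝ X, Renorming.IsEquivalentNorm p ∧
        Renorming.IsURED p ∧ ¬ Renorming.IsWUR p ∧ Renorming.IsLUR p) ∧
      Renorming.IsDenseClass {p : Seminorm ℝ X | Renorming.IsEquivalentNorm p ∧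
        Renorming.IsURED p ∧ ¬ Renorming.IsWUR p ∧ Renorming.IsLUR p}) :=
  theoremB_general hdim hURED
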